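/- Consider Lipschitz bandits on the arm space $\mathcal A=[0,1]^d$, $d\ge 1$, with the metric $d_{\mathcal A}(x,x')=\|x-x'\|_\infty$. A problem instance is a function $\mu:\mathcal A\to\mathbb R$ that is $1$-Lipschitz. At each time $t=1,\dots,T$ (with $T\ge 2$) the player pulls an arm $x_t\in\mathcal A$, which generates the reward $y_t=\mu(x_t)+\epsilon_t$, where $\epsilon_1,\dots,\epsilon_T$ are i.i.d. $N(0,1)$ and independent of the player's own randomness. Rewards are communicated in at most $B\ge 1$ rounds, at times of an adaptive grid $0=t_0\le t_1\le\dots\le t_B=T$: the time $t_j$ and the arms $x_t$ with $t_{j-1}<t\le t_j$ are chosen (measurably, possibly with randomization) on the basis of the rewards $y_1,\dots,y_{t_{j-1}}$ only. The regret of a policy $\pi$ is $R_T(\pi)=\sum_{t=1}^T\Delta_{x_t}$, where $\Delta_x=\max_{\mathcal A}\mu-\mu(x)$. For $r=2^{-i}$, $i\in\mathbb N=\{0,1,2,\dots\}$, let $N_r$ be the number of the $2^{di}$ standard dyadic cubes of edge length $r$ in $[0,1]^d$ that are contained in $S(16r)=\{x\in\mathcal A:\Delta_x\le 16r\}$, and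 let $$R_z(T)=\inf_{r_0>0}\Big\{r_0T+\sum_{r=2^{-i},\,i\in\mathbb N,\;r\ge r_0}\frac{N_r}{r}\log T\Big\}.$$ Then there is an absolute constant $c>0$ (independent of $d$, $T$, $B$, the policy and its grid) such that for all $d\ge1$, $T\ge 2$, $B\ge 1$ and every such policy $\pi$ with an adaptive grid there exists an instance $\mu$ with $$\mathbb E[R_T(\pi)]\;\ge\; c\,\frac1{B^2}\,(\log T)^{-\frac{\frac1{d+2}}{1-\left(\frac1{d+2}\right)^B}}\,R_z(T)^{\frac1{1-\left(\frac1{d+2}\right)^B}},$$ where the expectation is taken under the instance $\mu$ and $R_z(T)$ is that of the instance $\mu$. -/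

import Mathlib

noncomputable section

namespace LipschitzBandit

/-- The arm space `[0,1]^d`. Its metric is the one inherited from `Fin d → ℝ`, i.e. the
sup-norm metric. -/
abbrev Arm (d : ℕ) : Type := Set.Icc (0 : Fin d → ℝ) 1

/-- The optimality gap `Δ_x = μ* - μ(x)`. -/
def gap {d : ℕ} (μ : Arm d → ℝ) (x : Arm d) : ℝ := (⨆ z, μ z) - μ x

/-- The set `S(r)` of `r`-optimal arms. -/
def nearOptimal {d : ℕ} (μ : Arm d → ℝ) (r : ℝ) : Set (Arm d) := {x | gap μ x ≤ r}

/-- The standard (dyadic) cube of edge length `2^{-i}` with integer coordinates `k`. -/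
def standardCube {d : ℕ} (i : ℕ) (k : Fin d → Fin (2 ^ i)) : Set (Arm d) :=
  {x | ∀ l, ((k l : ℕ) : ℝ) * (1 / 2) ^ i ≤ x.1 l ∧ x.1 l ≤ (((k l : ℕ) : ℝ) + 1) * (1 / 2) ^ i}

/-- The zooming number `N_r` for `r = 2^{-i}`: the number of standard cubes of edge length `r`
that are contained in `S(16 r)`. -/
def zoomingNumber {d : ℕ} (μ : Arm d → ℝ) (i : ℕ) : ℕ :=
  Set.ncard {k : Fin d → Fin (2 ^ i) | standardCube i k ⊆ nearOptimal μ (16 * (1 / 2) ^ i)}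

/-- `R_z(T) = inf_{r₀ > 0} { r₀ T + ∑_{r = 2^{-i}, r ≥ r₀} (N_r / r) log T }`.
The inner sum has finitely many terms as `r₀ > 0`. -/
def zoomingRate {d : ℕ} (μ : Arm d → ℝ) (T : ℕ) : ℝ :=
  ⨅ r₀ : Set.Ioi (0 : ℝ), ((r₀ : ℝ) * T +
    ∑ᶠ (i : ℕ) (_ : (r₀ : ℝ) ≤ (1 / 2) ^ i),
      (zoomingNumber μ i : ℝ) / (1 / 2) ^ i * Real.log T)

/-- A (possibly randomized) policy for horizon `T` with an adaptively determined grid and at most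
`B` rounds of communication. All randomness of the player is in the seed `s : S`; `y` is the
sequence of rewards of the `T` rounds, and round `t : Fin T` is the time step `t + 1`.
Batch `j + 1` consists of the rounds `t` with `t_j ≤ t < t_{j+1}`. Repeated grid points (empty
batches) are allowed, so that policies using fewer than `B` rounds of communication are
included. -/
structure AdaptivePolicy (d T B : ℕ) (S : Type*) [MeasurableSpace S] where
  /-- the communication times `0 = t_0 ≤ t_1 ≤ ⋯ ≤ t_B = T` -/
  grid : Fin (B + 1) → S → (Fin T → ℝ) → ℕ
  /-- the arm pulled in round `t` -/
  arm : Fin T → S → (Fin T → ℝ) → Arm d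
  grid_zero : ∀ s y, grid 0 s y = 0
  grid_last : ∀ s y, grid (Fin.last B) s y = T
  grid_mono : ∀ s y, Monotone fun j => grid j s y
  /-- `t_{j+1}` is decided on the basis of the seed and of the rewards communicated up to `t_j` -/
  grid_adapted : ∀ (j : Fin B) s y y',
    (∀ i : Fin T, (i : ℕ) < grid j.castSucc s y → y i = y' i) →
      grid j.succ s y = grid j.succ s y'
  /-- the arms of batch `j + 1` are decided on the basis of the seed and of the rewards
  communicated up to `t_j` -/
  arm_adapted : ∀ (j : Fin B) s y y' (t : Fin T),
    grid j.castSucc s y ≤ t → t < grid j.succ s y →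
    (∀ i : Fin T, (i : ℕ) < grid j.castSucc s y → y i = y' i) →
      arm t s y = arm t s y'
  measurable_grid : ∀ j, Measurable fun p : S × (Fin T → ℝ) => grid j p.1 p.2
  measurable_arm : ∀ t, Measurable fun p : S × (Fin T → ℝ) => arm t p.1 p.2

namespace AdaptivePolicy

variable {d T B : ℕ} {S : Type*} [MeasurableSpace S]

/-- The rewards of the first `n` rounds (followed by zeros) when the expected reward function is
`μ`, the seed is `s` and the noise is `ε`: in round `t` the reward is
`μ(x_t) + ε_t`, where `x_t` is the arm that is pulled. -/
def partialRewards (π : AdaptivePolicy d T B S) (μ : Arm d → ℝ) (s : S) (ε : Fin T → ℝ) :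
    ℕ → Fin T → ℝ
  | 0 => fun _ => 0
  | n + 1 => fun t =>
      if (t : ℕ) = n then μ (π.arm t s (partialRewards π μ s ε n)) + ε t
      else partialRewards π μ s ε n t

/-- The rewards `y_t` of all `T` rounds. -/
def rewards (π : AdaptivePolicy d T B S) (μ : Arm d → ℝ) (s : S) (ε : Fin T → ℝ) : Fin T → ℝ :=
  π.partialRewards μ s ε T

theorem exists_batch (π : AdaptivePolicy d T B S) (s : S) (y : Fin T → ℝ) (t : Fin T) :
    ∃ j : Fin B, π.grid j.castSucc s y ≤ t ∧ (t : ℕ) < π.grid j.succ s y := by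
  by_contra! h
  have key : ∀ j : Fin (B + 1), π.grid j s y ≤ t := by
    intro j
    induction j using Fin.induction with
    | zero => rw [π.grid_zero]; exact Nat.zero_le _
    | succ j ih => exact h j ih
  have h1 := key (Fin.last B)
  rw [π.grid_last] at h1
  exact absurd t.2 (not_lt.mpr h1)

theorem arm_congr (π : AdaptivePolicy d T B S) (s : S) (y y' : Fin T → ℝ) (t : Fin T)
    (h : ∀ i : Fin T, i < t → y i = y' i) : π.arm t s y = π.arm t s y' := by
  obtain ⟨j, h1, h2⟩ := π.exists_batch s y t
  exact π.arm_adapted j s y y' t h1 h2 fun i hi => h i (Fin.lt_def.mpr (lt_of_lt_of_le hi h1))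

theorem partialRewards_stable (π : AdaptivePolicy d T B S) (μ : Arm d → ℝ) (s : S)
    (ε : Fin T → ℝ) (t : Fin T) (m n : ℕ) (hm : (t : ℕ) < m) (hmn : m ≤ n) :
    π.partialRewards μ s ε n t = π.partialRewards μ s ε m t := by
  induction n, hmn using Nat.le_induction with
  | base => rfl
  | succ n hn ih =>
    have : (t : ℕ) ≠ n := by omega
    simp only [partialRewards, if_neg this, ih]

/-- The rewards satisfy `y_t = μ(x_t) + ε_t`, where `x_t` is the arm that the policy pulls in
round `t`. -/
theorem rewards_eq (π : AdaptivePolicy d T B S) (μ : Arm d → ℝ) (s : S) (ε : Fin T → ℝ)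
    (t : Fin T) :
    π.rewards μ s ε t = μ (π.arm t s (π.rewards μ s ε)) + ε t := by
  have h1 : π.rewards μ s ε t = π.partialRewards μ s ε (t + 1) t :=
    π.partialRewards_stable μ s ε t (t + 1) T (Nat.lt_succ_self _) t.2
  rw [h1]
  simp only [partialRewards, if_true]
  congr 2
  refine π.arm_congr s _ _ t fun i hi => ?_
  exact (π.partialRewards_stable μ s ε i t T hi t.2.le).symm

/-- The regret `R_T(π) = ∑_{t = 1}^T (μ* - μ(x_t))`. -/
def regret (π : AdaptivePolicy d T B S) (μ : Arm d → ℝ) (s : S) (ε : Fin T → ℝ) : ℝ :=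
  ∑ t : Fin T, gap μ (π.arm t s (π.rewards μ s ε))

/-- The expected regret: the seed has law `P` and, independently, the noise variables are
independent standard Gaussians. -/
def expectedRegret (π : AdaptivePolicy d T B S) (P : MeasureTheory.Measure S)
    (μ : Arm d → ℝ) : ℝ :=
  ∫ ω : S × (Fin T → ℝ), π.regret μ ω.1 ω.2
    ∂(P.prod (MeasureTheory.Measure.pi fun _ : Fin T => ProbabilityTheory.gaussianReal 0 1))

end AdaptivePolicy

end LipschitzBandit

end

/-! With ρ = 1/(d+2), every instance satisfies R_z(T) ≤ 4 T^(1-ρ) (log T)^ρ (`zoomingRate_le`).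
After raising this to the power 1/(1-ρ^B), the logarithms cancel, and a minimax bound of order
T^((1-ρ)/(1-ρ^B)) / B² suffices (`exists_lipschitz_expectedRegret_ge`).

For that bound, fix reference times u_j with u_0 = 1 and u_B = T. However the grid is chosen, some
batch starts before u_j and lasts at least until u_{j+1}; by pigeonhole, one j has this property
with probability at least 1/B under the zero instance (`exists_longBatch_prob_ge`). On that event,
all arms before u_{j+1} depend on fewer than u_j rewards.

Place peaks of height r = 1/(2m) in the m^d disjoint cubes of a grid. An arm meets at most one peak,
so under the zero instance most peaks are missed, and the energy (the sum of squared means) is on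
average at most u_j r² / m^d per peak. When m^(d+2) is of order B² u_j, this is too little to detect
the peak: the change of measure `Predictable.lintegral_le_lintegral_drift` carries the misses over
to some peaked instance, whose regret is of order r u_{j+1} / B (`exists_expectedRegret_ge`). The
u_j are chosen to make this the same for all j, up to constants and powers of B. -/

namespace LipschitzBandit

/-! ### Gaussian integrals, one coordinate at a time -/

open MeasureTheory ProbabilityTheory
open scoped ENNReal

/-- Translating a standard Gaussian variable amounts to an exponential change of measure. -/
theorem lintegral_gaussianReal_add_const (c : ℝ) {f : ℝ → ℝ≥0∞} (hf : Measurable f) :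
    ∫⁻ z, f (z + c) ∂(gaussianReal 0 1) =
      ∫⁻ z, ENNReal.ofReal (Real.exp (c * z - c ^ 2 / 2)) * f z ∂(gaussianReal 0 1) := by
  have h1 : ∫⁻ z, f (z + c) ∂(gaussianReal 0 1) = ∫⁻ z, f z ∂(gaussianReal c 1) := by
    rw [← lintegral_map (g := fun z => z + c) hf (by fun_prop)]
    have := gaussianReal_map_add_const (μ := 0) (v := 1) c
    rw [zero_add] at this
    rw [← this]
  rw [h1, gaussianReal_of_var_ne_zero _ one_ne_zero, gaussianReal_of_var_ne_zero _ one_ne_zero,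
    lintegral_withDensity_eq_lintegral_mul _ (measurable_gaussianPDF _ _) hf,
    lintegral_withDensity_eq_lintegral_mul _ (measurable_gaussianPDF _ _) (by fun_prop)]
  refine lintegral_congr fun z => ?_
  simp only [Pi.mul_apply, gaussianPDF_def, gaussianPDFReal_def]
  rw [← mul_assoc, ← ENNReal.ofReal_mul (by positivity),
    mul_assoc (√(2 * Real.pi * _))⁻¹, ← Real.exp_add]
  congr 4
  simp only [NNReal.coe_one]
  ring

theorem lintegral_gaussianReal_affine_sq (a b : ℝ) :
    ∫⁻ z, ENNReal.ofReal ((a + b * z) ^ 2) ∂(gaussianReal 0 1) =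
      ENNReal.ofReal (a ^ 2 + b ^ 2) := by
  have hid : MemLp id 2 (gaussianReal 0 1) := memLp_id_gaussianReal 2
  have h1 : Integrable (fun z : ℝ => z) (gaussianReal 0 1) := hid.integrable (by norm_num)
  have h2 : Integrable (fun z : ℝ => z ^ 2) (gaussianReal 0 1) := hid.integrable_sq
  have m1 : ∫ z, z ∂(gaussianReal 0 1) = 0 := by simp
  have m2 : ∫ z, z ^ 2 ∂(gaussianReal 0 1) = 1 := by
    have h := variance_id_gaussianReal (μ := 0) (v := 1)
    rw [variance_eq_sub hid] at h
    simpa [m1] using h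
  have he : ∀ z : ℝ, (a + b * z) ^ 2 = a ^ 2 + (2 * a * b) * z + b ^ 2 * z ^ 2 := fun z => by ring
  have hi : Integrable (fun z : ℝ => (a + b * z) ^ 2) (gaussianReal 0 1) := by
    simp_rw [he]
    exact ((integrable_const _).add (h1.const_mul _)).add (h2.const_mul _)
  rw [← ofReal_integral_eq_lintegral_ofReal hi (ae_of_all _ fun z => sq_nonneg _)]
  congr 1
  simp_rw [he]
  have ha : Integrable (fun z : ℝ => a ^ 2 + (2 * a * b) * z) (gaussianReal 0 1) :=
    (integrable_const _).add (h1.const_mul _)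
  rw [integral_add ha (h2.const_mul _),
    integral_add (integrable_const _) (h1.const_mul _), integral_const_mul, integral_const_mul,
    m1, m2]
  simp

/-- The law of `T` independent standard Gaussian variables. -/
noncomputable abbrev stdNoise (T : ℕ) : Measure (Fin T → ℝ) := Measure.pi fun _ : Fin T => gaussianReal 0 1

/-- Fubini: with coordinate `i` integrated out first, an identity for product Gaussians becomes a
one-dimensional one with the other coordinates frozen. -/
theorem lintegral_stdNoise_congr {T : ℕ} (i : Fin T) {f g : (Fin T → ℝ) → ℝ≥0∞}
    (hf : Measurable f) (hg : Measurable g)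
    (h : ∀ y : Fin T → ℝ, ∫⁻ z, f (Function.update y i z) ∂(gaussianReal 0 1) =
      ∫⁻ z, g (Function.update y i z) ∂(gaussianReal 0 1)) :
    ∫⁻ y, f y ∂(stdNoise T) = ∫⁻ y, g y ∂(stdNoise T) := by
  refine lintegral_eq_of_lmarginal_eq {i} hf hg ?_
  rw [lmarginal_singleton, lmarginal_singleton]
  funext y
  exact h y

theorem measurable_update_add {T : ℕ} (i : Fin T) {h : (Fin T → ℝ) → ℝ} (hm : Measurable h) :
    Measurable fun y : Fin T → ℝ => Function.update y i (y i + h y) := by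
  refine measurable_pi_lambda _ fun j => ?_
  rcases eq_or_ne j i with rfl | hj
  · simp only [Function.update_self]
    exact (measurable_pi_apply j).add hm
  · simpa [Function.update_of_ne hj] using measurable_pi_apply j

theorem lintegral_stdNoise_shift {T : ℕ} (i : Fin T) {h : (Fin T → ℝ) → ℝ} (hm : Measurable h)
    (hi : ∀ y z, h (Function.update y i z) = h y) {G : (Fin T → ℝ) → ℝ≥0∞} (hG : Measurable G) :
    ∫⁻ y, G (Function.update y i (y i + h y)) ∂(stdNoise T) =
      ∫⁻ y, ENNReal.ofReal (Real.exp (h y * y i - h y ^ 2 / 2)) * G y ∂(stdNoise T) := by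
  refine lintegral_stdNoise_congr i (hG.comp (measurable_update_add i hm)) (by fun_prop) fun y => ?_
  simp only [hi, Function.update_self, Function.update_idem]
  exact lintegral_gaussianReal_add_const (h y)
    (f := fun z => G (Function.update y i z)) (hG.comp (measurable_update y))

theorem lintegral_stdNoise_add_mul_sq {T : ℕ} (i : Fin T) {X h : (Fin T → ℝ) → ℝ}
    (hX : Measurable X) (hh : Measurable h) (hXi : ∀ y z, X (Function.update y i z) = X y)
    (hhi : ∀ y z, h (Function.update y i z) = h y) :
    ∫⁻ y, ENNReal.ofReal ((X y + h y * y i) ^ 2) ∂(stdNoise T) =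
      ∫⁻ y, ENNReal.ofReal (X y ^ 2) ∂(stdNoise T) +
        ∫⁻ y, ENNReal.ofReal (h y ^ 2) ∂(stdNoise T) := by
  rw [← lintegral_add_left (by fun_prop)]
  refine lintegral_stdNoise_congr i (by fun_prop) (by fun_prop) fun y => ?_
  simp only [hXi, hhi, Function.update_self]
  rw [lintegral_gaussianReal_affine_sq, lintegral_const,
    ENNReal.ofReal_add (sq_nonneg _) (sq_nonneg _)]
  simp

/-! ### Change of measure for predictable drifts -/

/-- A sequence `h` of functions of `y` is predictable if `h t` depends on `y` only through its
coordinates before `t`. -/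
def Predictable {T : ℕ} (h : Fin T → (Fin T → ℝ) → ℝ) : Prop :=
  ∀ t y y', (∀ i : Fin T, i < t → y i = y' i) → h t y = h t y'

section Predictable

variable {T : ℕ} {h : Fin T → (Fin T → ℝ) → ℝ}

/-- The indices before `n`. -/
def before (T n : ℕ) : Finset (Fin T) := Finset.univ.filter fun t => (t : ℕ) < n

theorem before_succ {n : ℕ} (hn : n < T) :
    before T (n + 1) = insert ⟨n, hn⟩ (before T n) := by
  ext t
  simp only [before, Finset.mem_filter, Finset.mem_univ, true_and, Finset.mem_insert, Fin.ext_iff]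
  omega

theorem notMem_before {n : ℕ} (hn : n < T) : (⟨n, hn⟩ : Fin T) ∉ before T n := by
  simp [before]

theorem mem_before {n : ℕ} {t : Fin T} : t ∈ before T n ↔ (t : ℕ) < n := by
  simp [before]

theorem before_zero : before T 0 = ∅ := by simp [before]

theorem card_before {n : ℕ} (hn : n ≤ T) : (before T n).card = n := by
  induction n with
  | zero => simp [before_zero]
  | succ n ih => rw [before_succ hn, Finset.card_insert_of_notMem (notMem_before hn), ih (by omega)]

theorem Predictable.update_eq (hp : Predictable h) {i t : Fin T} (hit : t ≤ i) (y : Fin T → ℝ)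
    (z : ℝ) : h t (Function.update y i z) = h t y :=
  hp t _ _ fun j hj => Function.update_of_ne (by rintro rfl; omega) _ _

theorem Predictable.update_of_before (hp : Predictable h) {n : ℕ} (hn : n < T) {t : Fin T}
    (ht : t ∈ before T n) (y : Fin T → ℝ) (z : ℝ) :
    h t (Function.update y ⟨n, hn⟩ z) = h t y :=
  hp.update_eq (Fin.le_def.mpr (mem_before.mp ht).le) y z

/-- The martingale `∑_{t < n} h_t y_t`. -/
def martingalePart (h : Fin T → (Fin T → ℝ) → ℝ) (n : ℕ) (y : Fin T → ℝ) : ℝ :=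
  ∑ t ∈ before T n, h t y * y t

/-- The quadratic variation `∑_{t < n} h_t ^ 2`. -/
def variationPart (h : Fin T → (Fin T → ℝ) → ℝ) (n : ℕ) (y : Fin T → ℝ) : ℝ :=
  ∑ t ∈ before T n, h t y ^ 2

theorem measurable_martingalePart (hm : ∀ t, Measurable (h t)) (n : ℕ) :
    Measurable (martingalePart h n) :=
  Finset.measurable_fun_sum _ fun t _ => (hm t).mul (measurable_pi_apply t)

theorem measurable_variationPart (hm : ∀ t, Measurable (h t)) (n : ℕ) :
    Measurable (variationPart h n) :=
  Finset.measurable_fun_sum _ fun t _ => (hm t).pow_const 2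

theorem variationPart_nonneg (n : ℕ) (y : Fin T → ℝ) : 0 ≤ variationPart h n y :=
  Finset.sum_nonneg fun _ _ => sq_nonneg _

theorem martingalePart_succ {n : ℕ} (hn : n < T) (y : Fin T → ℝ) :
    martingalePart h (n + 1) y = martingalePart h n y + h ⟨n, hn⟩ y * y ⟨n, hn⟩ := by
  rw [martingalePart, before_succ hn, Finset.sum_insert (notMem_before hn), add_comm]
  rfl

theorem variationPart_succ {n : ℕ} (hn : n < T) (y : Fin T → ℝ) :
    variationPart h (n + 1) y = variationPart h n y + h ⟨n, hn⟩ y ^ 2 := by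
  rw [variationPart, before_succ hn, Finset.sum_insert (notMem_before hn), add_comm]
  rfl

theorem Predictable.martingalePart_update (hp : Predictable h) {n : ℕ} (hn : n < T)
    (y : Fin T → ℝ) (z : ℝ) :
    martingalePart h n (Function.update y ⟨n, hn⟩ z) = martingalePart h n y := by
  refine Finset.sum_congr rfl fun t ht => ?_
  rw [hp.update_of_before hn ht, Function.update_of_ne]
  rintro rfl
  exact notMem_before hn ht

theorem Predictable.variationPart_update (hp : Predictable h) {n : ℕ} (hn : n < T)
    (y : Fin T → ℝ) (z : ℝ) :
    variationPart h n (Function.update y ⟨n, hn⟩ z) = variationPart h n y :=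
  Finset.sum_congr rfl fun t ht => by rw [hp.update_of_before hn ht]

/-- Itô isometry: the increment `h n * y n` has a centered factor independent of everything before
it, so the cross terms vanish. -/
theorem Predictable.lintegral_martingalePart_sq (hp : Predictable h) (hm : ∀ t, Measurable (h t))
    {n : ℕ} (hn : n ≤ T) :
    ∫⁻ y, ENNReal.ofReal (martingalePart h n y ^ 2) ∂(stdNoise T) =
      ∫⁻ y, ENNReal.ofReal (variationPart h n y) ∂(stdNoise T) := by
  induction n with
  | zero => simp [martingalePart, variationPart, before_zero]
  | succ n ih =>
    have hn' : n < T := hn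
    have hX := measurable_martingalePart hm n
    have hV := measurable_variationPart hm n
    simp only [martingalePart_succ hn', variationPart_succ hn']
    rw [lintegral_stdNoise_add_mul_sq ⟨n, hn'⟩ hX (hm _) (hp.martingalePart_update hn')
      (fun y z => hp.update_eq le_rfl y z), ih hn'.le, ← lintegral_add_left hV.ennreal_ofReal]
    refine lintegral_congr fun y => ?_
    rw [ENNReal.ofReal_add (variationPart_nonneg n y) (sq_nonneg _)]

/-- The likelihood ratio of the first `n` observations. -/
noncomputable def likelihood (h : Fin T → (Fin T → ℝ) → ℝ) (n : ℕ) (y : Fin T → ℝ) : ℝ :=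
  Real.exp (martingalePart h n y - variationPart h n y / 2)

theorem measurable_likelihood (hm : ∀ t, Measurable (h t)) (n : ℕ) :
    Measurable (likelihood h n) :=
  ((measurable_martingalePart hm n).sub ((measurable_variationPart hm n).div_const 2)).exp

/-- Change of measure: if `R n` arises from the noise by adding the predictable drift `h` to its
first `n` coordinates, then the law of `R n` has the density `likelihood h n`. -/
theorem Predictable.lintegral_drift (hp : Predictable h) (hm : ∀ t, Measurable (h t))
    (R : ℕ → (Fin T → ℝ) → Fin T → ℝ) (hR0 : ∀ ε, R 0 ε = ε)
    (hRs : ∀ n (hn : n < T) ε, R (n + 1) ε =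
      Function.update (R n ε) ⟨n, hn⟩ (R n ε ⟨n, hn⟩ + h ⟨n, hn⟩ (R n ε)))
    {n : ℕ} (hn : n ≤ T) {F : (Fin T → ℝ) → ℝ≥0∞} (hF : Measurable F) :
    ∫⁻ ε, F (R n ε) ∂(stdNoise T) =
      ∫⁻ y, ENNReal.ofReal (likelihood h n y) * F y ∂(stdNoise T) := by
  induction n generalizing F with
  | zero => simp [hR0, likelihood, martingalePart, variationPart, before_zero]
  | succ n ih =>
    have hn' : n < T := hn
    have hL := measurable_likelihood hm n
    simp only [hRs n hn']
    rw [ih hn'.le (F := fun y => F (Function.update y ⟨n, hn'⟩ (y ⟨n, hn'⟩ + h ⟨n, hn'⟩ y)))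
      (hF.comp (measurable_update_add _ (hm _)))]
    -- `likelihood h n` does not see coordinate `n`, so it passes through the translation and can be
    -- absorbed into the test function.
    have key := lintegral_stdNoise_shift ⟨n, hn'⟩ (hm ⟨n, hn'⟩)
      (fun y z => hp.update_eq le_rfl y z)
      (G := fun y => ENNReal.ofReal (likelihood h n y) * F y) (by fun_prop)
    simp only [likelihood, hp.martingalePart_update, hp.variationPart_update] at key ⊢
    rw [key]
    refine lintegral_congr fun y => ?_
    rw [← mul_assoc, ← ENNReal.ofReal_mul (by positivity), ← Real.exp_add,
      martingalePart_succ hn', variationPart_succ hn']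
    congr 3
    ring

/-- The expectation of a bounded statistic of the first `n` observations decreases only slightly
when a small drift is added. -/
theorem Predictable.lintegral_le_lintegral_drift (hp : Predictable h)
    (hm : ∀ t, Measurable (h t))
    (R : ℕ → (Fin T → ℝ) → Fin T → ℝ) (hR0 : ∀ ε, R 0 ε = ε)
    (hRs : ∀ n (hn : n < T) ε, R (n + 1) ε =
      Function.update (R n ε) ⟨n, hn⟩ (R n ε ⟨n, hn⟩ + h ⟨n, hn⟩ (R n ε)))
    {n : ℕ} (hn : n ≤ T) {F : (Fin T → ℝ) → ℝ} (hF : Measurable F) {τ : ℝ}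
    (hF0 : ∀ y, 0 ≤ F y) (hFτ : ∀ y, F y ≤ τ) {c : ℝ} (hc : 0 < c) :
    ∫⁻ y, ENNReal.ofReal (F y) ∂(stdNoise T) ≤
      ∫⁻ ε, ENNReal.ofReal (F (R n ε)) ∂(stdNoise T) +
        ENNReal.ofReal τ * (ENNReal.ofReal (1 / (2 * c)) + ENNReal.ofReal ((c + 1) / 2) *
          ∫⁻ y, ENNReal.ofReal (variationPart h n y) ∂(stdNoise T)) := by
  have hX := measurable_martingalePart hm n
  have hV := measurable_variationPart hm n
  have hL := measurable_likelihood hm n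
  have hτ : 0 ≤ τ := (hF0 0).trans (hFτ 0)
  rw [hp.lintegral_drift hm R hR0 hRs hn hF.ennreal_ofReal]
  have e : ENNReal.ofReal (1 / (2 * c)) + ENNReal.ofReal ((c + 1) / 2) *
        ∫⁻ y, ENNReal.ofReal (variationPart h n y) ∂(stdNoise T) =
      ∫⁻ y, (ENNReal.ofReal (1 / (2 * c)) + ENNReal.ofReal (c / 2 * martingalePart h n y ^ 2) +
        ENNReal.ofReal (1 / 2 * variationPart h n y)) ∂(stdNoise T) := by
    rw [lintegral_add_left (by fun_prop), lintegral_add_left (by fun_prop), lintegral_const,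
      measure_univ, mul_one]
    simp_rw [ENNReal.ofReal_mul (show (0 : ℝ) ≤ c / 2 by positivity),
      ENNReal.ofReal_mul (show (0 : ℝ) ≤ 1 / 2 by norm_num)]
    rw [lintegral_const_mul _ (by fun_prop), lintegral_const_mul _ (by fun_prop),
      hp.lintegral_martingalePart_sq hm hn, add_assoc, ← add_mul,
      ← ENNReal.ofReal_add (by positivity) (by norm_num)]
    congr 3
    ring_nf
  rw [e, ← lintegral_const_mul _ (by fun_prop), ← lintegral_add_left (by fun_prop)]
  refine lintegral_mono fun y => ?_
  have hv := variationPart_nonneg (h := h) n y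
  have hl : 0 ≤ likelihood h n y := (Real.exp_pos _).le
  simp only []
  rw [← ENNReal.ofReal_add (by positivity) (by positivity),
    ← ENNReal.ofReal_add (by positivity) (by positivity), ← ENNReal.ofReal_mul hτ,
    ← ENNReal.ofReal_mul hl,
    ← ENNReal.ofReal_add (mul_nonneg hl (hF0 y)) (by positivity)]
  refine ENNReal.ofReal_le_ofReal ?_
  set X := martingalePart h n y
  set V := variationPart h n y
  -- The tangent bound for exp needs only the second moment of `X` under pure noise, which the
  -- isometry turns into the energy.
  have h1 : 1 + (X - V / 2) ≤ likelihood h n y := by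
    rw [likelihood]; linarith [Real.add_one_le_exp (X - V / 2)]
  have h2 : -X ≤ 1 / (2 * c) + c / 2 * X ^ 2 := by
    have : 1 / (2 * c) + c / 2 * X ^ 2 + X = (c * X + 1) ^ 2 / (2 * c) := by
      field_simp; ring
    have h3 : 0 ≤ (c * X + 1) ^ 2 / (2 * c) := by positivity
    linarith
  set W := 1 / (2 * c) + c / 2 * X ^ 2 + 1 / 2 * V with hW
  have hW0 : 0 ≤ W := by positivity
  have h3 : 1 - W ≤ likelihood h n y := by rw [hW]; linarith
  -- F = (1 - W) F + W F ≤ L F + τ W, where L is the likelihood.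
  nlinarith [mul_le_mul_of_nonneg_right h3 (hF0 y), mul_le_mul_of_nonneg_left (hFτ y) hW0]

end Predictable

end LipschitzBandit

namespace LipschitzBandit

open MeasureTheory ProbabilityTheory
open scoped ENNReal

/-! ### Change of measure for a policy -/

namespace AdaptivePolicy

variable {d T B : ℕ} {S : Type*} [MeasurableSpace S]

theorem measurable_arm_comp (π : AdaptivePolicy d T B S) {μ : Arm d → ℝ} (hμ : Measurable μ)
    (t : Fin T) : Measurable fun p : S × (Fin T → ℝ) => μ (π.arm t p.1 p.2) :=
  hμ.comp (π.measurable_arm t)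

theorem measurable_partialRewards (π : AdaptivePolicy d T B S) {μ : Arm d → ℝ}
    (hμ : Measurable μ) (n : ℕ) :
    Measurable fun p : S × (Fin T → ℝ) => π.partialRewards μ p.1 p.2 n := by
  induction n with
  | zero => exact measurable_const
  | succ n ih =>
    refine measurable_pi_lambda _ fun t => ?_
    simp only [partialRewards]
    split_ifs
    · exact ((π.measurable_arm_comp hμ t).comp (measurable_fst.prodMk ih)).add
        ((measurable_pi_apply t).comp measurable_snd)
    · exact (measurable_pi_apply t).comp ih

theorem measurable_rewards (π : AdaptivePolicy d T B S) {μ : Arm d → ℝ} (hμ : Measurable μ) :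
    Measurable fun p : S × (Fin T → ℝ) => π.rewards μ p.1 p.2 :=
  π.measurable_partialRewards hμ T

/-- The mean rewards of the arms that are pulled. -/
def drift (π : AdaptivePolicy d T B S) (μ : Arm d → ℝ) (s : S) (t : Fin T) (y : Fin T → ℝ) : ℝ :=
  μ (π.arm t s y)

theorem predictable_drift (π : AdaptivePolicy d T B S) (μ : Arm d → ℝ) (s : S) :
    Predictable (π.drift μ s) :=
  fun t y y' h => congrArg μ (π.arm_congr s y y' t h)

theorem measurable_drift (π : AdaptivePolicy d T B S) {μ : Arm d → ℝ} (hμ : Measurable μ) (s : S)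
    (t : Fin T) : Measurable (π.drift μ s t) :=
  (π.measurable_arm_comp hμ t).comp measurable_prodMk_left

/-- The rewards in the first `n` rounds, and the bare noise afterwards. -/
def hybrid (π : AdaptivePolicy d T B S) (μ : Arm d → ℝ) (s : S) (n : ℕ) (ε : Fin T → ℝ)
    (t : Fin T) : ℝ :=
  if (t : ℕ) < n then π.rewards μ s ε t else ε t

/-- The arm of round `n` depends only on earlier rewards, on which the hybrid sequence and the true
rewards agree. Rewards thus arise from noise by adding predictable drifts one at a time. -/
theorem hybrid_succ (π : AdaptivePolicy d T B S) (μ : Arm d → ℝ) (s : S) {n : ℕ} (hn : n < T)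
    (ε : Fin T → ℝ) :
    π.hybrid μ s (n + 1) ε = Function.update (π.hybrid μ s n ε) ⟨n, hn⟩
      (π.hybrid μ s n ε ⟨n, hn⟩ + π.drift μ s ⟨n, hn⟩ (π.hybrid μ s n ε)) := by
  funext t
  rcases eq_or_ne t ⟨n, hn⟩ with rfl | ht
  · rw [Function.update_self, hybrid, if_pos (Nat.lt_succ_self n), hybrid, if_neg (lt_irrefl n),
      π.rewards_eq, add_comm]
    congr 1
    refine π.predictable_drift μ s ⟨n, hn⟩ _ _ fun i hi => ?_
    rw [hybrid, if_pos (Fin.lt_def.mp hi)]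
  · have : (t : ℕ) ≠ n := fun h => ht (Fin.ext h)
    rw [Function.update_of_ne ht, hybrid, hybrid]
    by_cases h : (t : ℕ) < n
    · rw [if_pos h, if_pos (h.trans (Nat.lt_succ_self n))]
    · rw [if_neg h, if_neg (by omega)]

/-- The sum of the squared mean rewards in the first `n` rounds. -/
def energy (π : AdaptivePolicy d T B S) (μ : Arm d → ℝ) (n : ℕ) (p : S × (Fin T → ℝ)) : ℝ :=
  variationPart (π.drift μ p.1) n p.2

theorem measurable_energy (π : AdaptivePolicy d T B S) {μ : Arm d → ℝ} (hμ : Measurable μ)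
    (n : ℕ) : Measurable (π.energy μ n) := by
  unfold energy variationPart drift
  exact Finset.measurable_fun_sum _ fun t _ => (π.measurable_arm_comp hμ t).pow_const 2

/-- The left side is an expectation under the zero instance, where rewards are bare noise, and so is
the energy. The drift estimate is applied for each fixed seed; as `F` sees only the first `n`
rewards, the hybrid sequence may be replaced by the true one. -/
theorem lintegral_le_lintegral_rewards (π : AdaptivePolicy d T B S) (P : Measure S)
    [IsProbabilityMeasure P] {μ : Arm d → ℝ} (hμ : Measurable μ) {n : ℕ} (hn : n ≤ T)
    {F : S × (Fin T → ℝ) → ℝ} (hF : Measurable F) {τ : ℝ} (hF0 : ∀ p, 0 ≤ F p)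
    (hFτ : ∀ p, F p ≤ τ)
    (hFn : ∀ s y y', (∀ i : Fin T, (i : ℕ) < n → y i = y' i) → F (s, y) = F (s, y'))
    {c : ℝ} (hc : 0 < c) :
    ∫⁻ p, ENNReal.ofReal (F p) ∂(P.prod (stdNoise T)) ≤
      ∫⁻ p, ENNReal.ofReal (F (p.1, π.rewards μ p.1 p.2)) ∂(P.prod (stdNoise T)) +
        ENNReal.ofReal τ * (ENNReal.ofReal (1 / (2 * c)) + ENNReal.ofReal ((c + 1) / 2) *
          ∫⁻ p, ENNReal.ofReal (π.energy μ n p) ∂(P.prod (stdNoise T))) := by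
  have hR : Measurable fun p : S × (Fin T → ℝ) => F (p.1, π.rewards μ p.1 p.2) :=
    hF.comp (measurable_fst.prodMk (π.measurable_rewards hμ))
  have hE := π.measurable_energy hμ n
  rw [lintegral_prod _ hF.ennreal_ofReal.aemeasurable,
    lintegral_prod _ hR.ennreal_ofReal.aemeasurable,
    lintegral_prod _ hE.ennreal_ofReal.aemeasurable]
  have e : ENNReal.ofReal (1 / (2 * c)) = ∫⁻ _ : S, ENNReal.ofReal (1 / (2 * c)) ∂P := by simp
  have hEm : Measurable fun s : S => ENNReal.ofReal (1 / (2 * c)) + ENNReal.ofReal ((c + 1) / 2) *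
      ∫⁻ y, ENNReal.ofReal (π.energy μ n (s, y)) ∂(stdNoise T) :=
    measurable_const.add (hE.ennreal_ofReal.lintegral_prod_right'.const_mul _)
  rw [e, ← lintegral_const_mul _ hE.ennreal_ofReal.lintegral_prod_right',
    ← lintegral_add_left measurable_const, ← lintegral_const_mul _ hEm,
    ← lintegral_add_left hR.ennreal_ofReal.lintegral_prod_right']
  refine lintegral_mono fun s => ?_
  have key := (π.predictable_drift μ s).lintegral_le_lintegral_drift (π.measurable_drift hμ s)
    (π.hybrid μ s) (fun ε => by funext t; simp [hybrid]) (fun n hn ε => π.hybrid_succ μ s hn ε) hn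
    (F := fun y => F (s, y)) (hF.comp measurable_prodMk_left) (fun y => hF0 _) (fun y => hFτ _) hc
  have h2 : ∀ ε, F (s, π.hybrid μ s n ε) = F (s, π.rewards μ s ε) := fun ε =>
    hFn s _ _ fun i hi => by rw [hybrid, if_pos hi]
  simp only [h2] at key
  exact key

theorem integral_le_integral_rewards (π : AdaptivePolicy d T B S) (P : Measure S)
    [IsProbabilityMeasure P] {μ : Arm d → ℝ} (hμ : Measurable μ) {r : ℝ}
    (hμ0 : ∀ x, 0 ≤ μ x) (hμr : ∀ x, μ x ≤ r) {n : ℕ} (hn : n ≤ T)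
    {F : S × (Fin T → ℝ) → ℝ} (hF : Measurable F) {τ : ℝ} (hF0 : ∀ p, 0 ≤ F p)
    (hFτ : ∀ p, F p ≤ τ)
    (hFn : ∀ s y y', (∀ i : Fin T, (i : ℕ) < n → y i = y' i) → F (s, y) = F (s, y'))
    {c : ℝ} (hc : 0 < c) :
    Integrable (π.energy μ n) (P.prod (stdNoise T)) ∧
    ∫ p, F p ∂(P.prod (stdNoise T)) ≤
      ∫ p, F (p.1, π.rewards μ p.1 p.2) ∂(P.prod (stdNoise T)) +
        τ * (1 / (2 * c) + (c + 1) / 2 * ∫ p, π.energy μ n p ∂(P.prod (stdNoise T))) := by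
  have hR : Measurable fun p : S × (Fin T → ℝ) => F (p.1, π.rewards μ p.1 p.2) :=
    hF.comp (measurable_fst.prodMk (π.measurable_rewards hμ))
  have hE := π.measurable_energy hμ n
  have hE0 : ∀ p, 0 ≤ π.energy μ n p := fun p => variationPart_nonneg n p.2
  have hEi : Integrable (π.energy μ n) (P.prod (stdNoise T)) := by
    refine Integrable.of_bound hE.aestronglyMeasurable ((before T n).card • r ^ 2)
      (ae_of_all _ fun p => ?_)
    rw [Real.norm_of_nonneg (hE0 p)]
    unfold energy variationPart drift
    exact Finset.sum_le_card_nsmul _ _ _ fun t _ => pow_le_pow_left₀ (hμ0 _) (hμr _) 2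
  have hFi : Integrable F (P.prod (stdNoise T)) :=
    Integrable.of_bound hF.aestronglyMeasurable τ
      (ae_of_all _ fun p => by rw [Real.norm_of_nonneg (hF0 p)]; exact hFτ p)
  have hRi : Integrable (fun p : S × (Fin T → ℝ) => F (p.1, π.rewards μ p.1 p.2))
      (P.prod (stdNoise T)) :=
    Integrable.of_bound hR.aestronglyMeasurable τ
      (ae_of_all _ fun p => by rw [Real.norm_of_nonneg (hF0 _)]; exact hFτ _)
  refine ⟨hEi, ?_⟩
  have hne : Nonempty (S × (Fin T → ℝ)) := (P.prod (stdNoise T)).nonempty_of_neZero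
  have hτ : 0 ≤ τ := (hF0 hne.some).trans (hFτ _)
  have key := π.lintegral_le_lintegral_rewards P hμ hn hF hF0 hFτ hFn hc
  have hI : 0 ≤ ∫ p, π.energy μ n p ∂(P.prod (stdNoise T)) := integral_nonneg hE0
  rw [← ofReal_integral_eq_lintegral_ofReal hFi (ae_of_all _ hF0),
    ← ofReal_integral_eq_lintegral_ofReal hRi (ae_of_all _ fun p => hF0 _),
    ← ofReal_integral_eq_lintegral_ofReal hEi (ae_of_all _ hE0),
    ← ENNReal.ofReal_mul (by positivity), ← ENNReal.ofReal_add (by positivity) (by positivity),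
    ← ENNReal.ofReal_mul hτ, ← ENNReal.ofReal_add (integral_nonneg fun p => hF0 _)
      (by positivity)] at key
  exact (ENNReal.ofReal_le_ofReal_iff
    (add_nonneg (integral_nonneg fun p => hF0 _) (by positivity))).mp key

/-! ### Long batches and missed peaks -/

theorem grid_congr (π : AdaptivePolicy d T B S) (s : S) {y y' : Fin T → ℝ} (j : Fin B)
    (h : ∀ i : Fin T, (i : ℕ) < π.grid j.castSucc s y → y i = y' i) (l : Fin (B + 1))
    (hl : l ≤ j.succ) : π.grid l s y = π.grid l s y' := by
  induction l using Fin.induction with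
  | zero => rw [π.grid_zero, π.grid_zero]
  | succ l _ =>
    refine π.grid_adapted l s y y' fun i hi => h i (hi.trans_le (π.grid_mono s y ?_))
    exact Fin.castSucc_le_castSucc_iff.mpr (Fin.succ_le_succ_iff.mp hl)

theorem arm_congr_of_lt_grid (π : AdaptivePolicy d T B S) (s : S) {y y' : Fin T → ℝ} (j : Fin B)
    (h : ∀ i : Fin T, (i : ℕ) < π.grid j.castSucc s y → y i = y' i) (t : Fin T)
    (ht : (t : ℕ) < π.grid j.succ s y) : π.arm t s y = π.arm t s y' := by
  obtain ⟨l, h1, h2⟩ := π.exists_batch s y t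
  refine π.arm_adapted l s y y' t h1 h2 fun i hi => h i (hi.trans_le (π.grid_mono s y ?_))
  by_contra hlj
  have h3 : j.succ ≤ l.castSucc := by
    rw [Fin.le_def] at hlj ⊢
    simp only [Fin.val_castSucc, Fin.val_succ] at hlj ⊢
    omega
  have := π.grid_mono s y h3
  simp only [] at this
  omega

/-- The event that batch `j + 1` starts before time `n` and does not end before time `τ`. -/
def longBatch (π : AdaptivePolicy d T B S) (j : Fin B) (n τ : ℕ) : Set (S × (Fin T → ℝ)) :=
  {p | π.grid j.castSucc p.1 p.2 < n ∧ τ ≤ π.grid j.succ p.1 p.2}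

theorem measurableSet_longBatch (π : AdaptivePolicy d T B S) (j : Fin B) (n τ : ℕ) :
    MeasurableSet (π.longBatch j n τ) :=
  (measurableSet_lt (π.measurable_grid j.castSucc) measurable_const).inter
    (measurableSet_le measurable_const (π.measurable_grid j.succ))

theorem mem_longBatch_congr (π : AdaptivePolicy d T B S) (j : Fin B) {n τ : ℕ} {s : S}
    {y y' : Fin T → ℝ} (h : ∀ i : Fin T, (i : ℕ) < n → y i = y' i)
    (hy : (s, y) ∈ π.longBatch j n τ) : (s, y') ∈ π.longBatch j n τ := by
  have h' := π.grid_congr s j fun i hi => h i (hi.trans hy.1)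
  have h1 := h' j.castSucc (Fin.castSucc_lt_succ).le
  have h2 := h' j.succ le_rfl
  exact ⟨h1 ▸ hy.1, h2 ▸ hy.2⟩

/-- The number of pulls before time `τ` of arms with mean reward zero, on the event `longBatch`. -/
noncomputable def missCount (π : AdaptivePolicy d T B S) (μ : Arm d → ℝ) (j : Fin B) (n τ : ℕ) :
    S × (Fin T → ℝ) → ℝ :=
  (π.longBatch j n τ).indicator fun p =>
    ∑ t ∈ before T τ, {x | μ x = 0}.indicator (fun _ => (1 : ℝ)) (π.arm t p.1 p.2)

theorem measurable_missCount (π : AdaptivePolicy d T B S) {μ : Arm d → ℝ} (hμ : Measurable μ)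
    (j : Fin B) (n τ : ℕ) : Measurable (π.missCount μ j n τ) := by
  refine Measurable.indicator ?_ (π.measurableSet_longBatch j n τ)
  exact Finset.measurable_fun_sum _ fun t _ =>
    (measurable_const.indicator (hμ (measurableSet_singleton 0))).comp (π.measurable_arm t)

/-- This is where batching enters: on the long-batch event, every arm before `τ` belongs to batch `j
+ 1` or an earlier one, hence was fixed by rewards before `t_j < n`. -/
theorem missCount_congr (π : AdaptivePolicy d T B S) (μ : Arm d → ℝ) (j : Fin B) (n τ : ℕ) (s : S)
    (y y' : Fin T → ℝ) (h : ∀ i : Fin T, (i : ℕ) < n → y i = y' i) :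
    π.missCount μ j n τ (s, y) = π.missCount μ j n τ (s, y') := by
  by_cases hy : (s, y) ∈ π.longBatch j n τ
  · have hy' := π.mem_longBatch_congr j h hy
    rw [missCount, Set.indicator_of_mem hy, Set.indicator_of_mem hy']
    refine Finset.sum_congr rfl fun t ht => ?_
    rw [π.arm_congr_of_lt_grid s j (fun i hi => h i (hi.trans hy.1)) t
      ((mem_before.mp ht).trans_le hy.2)]
  · have hy' : (s, y') ∉ π.longBatch j n τ := fun h' =>
      hy (π.mem_longBatch_congr j (fun i hi => (h i hi).symm) h')
    rw [missCount, Set.indicator_of_notMem hy, Set.indicator_of_notMem hy']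

theorem missCount_nonneg (π : AdaptivePolicy d T B S) (μ : Arm d → ℝ) (j : Fin B) (n τ : ℕ)
    (p : S × (Fin T → ℝ)) : 0 ≤ π.missCount μ j n τ p :=
  Set.indicator_nonneg (fun _ _ => Finset.sum_nonneg fun _ _ =>
    Set.indicator_nonneg (fun _ _ => zero_le_one) _) _

theorem missCount_le (π : AdaptivePolicy d T B S) (μ : Arm d → ℝ) (j : Fin B) (n : ℕ) {τ : ℕ}
    (hτ : τ ≤ T) (p : S × (Fin T → ℝ)) : π.missCount μ j n τ p ≤ τ := by
  refine Set.indicator_apply_le' (fun _ => ?_) fun _ => Nat.cast_nonneg _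
  have := Finset.sum_le_card_nsmul (before T τ)
    (fun t => {x | μ x = 0}.indicator (fun _ => (1 : ℝ)) (π.arm t p.1 p.2)) 1
    fun t _ => Set.indicator_le_self' (fun _ _ => zero_le_one) _
  simpa [card_before hτ] using this

theorem gap_eq_of_max {μ : Arm d → ℝ} {r : ℝ} (hμr : ∀ x, μ x ≤ r) {z : Arm d} (hz : μ z = r)
    (x : Arm d) : gap μ x = r - μ x := by
  have : (⨆ z, μ z) = r := by
    have : Nonempty (Arm d) := ⟨z⟩
    exact le_antisymm (ciSup_le hμr) (hz ▸ le_ciSup ⟨r, by rintro _ ⟨x, rfl⟩; exact hμr x⟩ z)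
  rw [gap, this]

/-- An arm with mean zero has gap `r`, and all other gaps are nonnegative. -/
theorem integral_missCount_le_expectedRegret (π : AdaptivePolicy d T B S) (P : Measure S)
    [IsProbabilityMeasure P] {μ : Arm d → ℝ} (hμ : Measurable μ) {r : ℝ}
    (hμ0 : ∀ x, 0 ≤ μ x) (hμr : ∀ x, μ x ≤ r) (hz : ∃ z, μ z = r) (j : Fin B) (n : ℕ) {τ : ℕ}
    (hτ : τ ≤ T) :
    r * ∫ p, π.missCount μ j n τ (p.1, π.rewards μ p.1 p.2) ∂(P.prod (stdNoise T)) ≤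
      π.expectedRegret P μ := by
  obtain ⟨z, hz⟩ := hz
  have hr : 0 ≤ r := hz ▸ hμ0 z
  have hgap := gap_eq_of_max hμr hz
  have hm : Measurable fun p : S × (Fin T → ℝ) => (p.1, π.rewards μ p.1 p.2) :=
    measurable_fst.prodMk (π.measurable_rewards hμ)
  rw [expectedRegret, ← integral_const_mul]
  refine integral_mono ?_ ?_ fun p => ?_
  · refine (Integrable.of_bound
      ((π.measurable_missCount hμ j n τ).comp hm).aestronglyMeasurable τ
      (ae_of_all _ fun p => ?_)).const_mul r
    rw [Function.comp_apply, Real.norm_of_nonneg (π.missCount_nonneg _ _ _ _ _)]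
    exact π.missCount_le _ _ _ hτ _
  · refine Integrable.of_bound (C := ∑ t : Fin T, r)
      (Measurable.aestronglyMeasurable ?_) (ae_of_all _ fun p => ?_)
    · refine Finset.measurable_fun_sum _ fun t _ => ?_
      simp only [hgap]
      exact measurable_const.sub ((π.measurable_arm_comp hμ t).comp hm)
    · rw [Real.norm_of_nonneg]
      · exact Finset.sum_le_sum fun t _ => by rw [hgap]; linarith [hμ0 (π.arm t p.1
          (π.rewards μ p.1 p.2))]
      · exact Finset.sum_nonneg fun t _ => by rw [hgap]; linarith [hμr (π.arm t p.1
          (π.rewards μ p.1 p.2))]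
  · have h1 : ∀ x, r * {x | μ x = 0}.indicator (fun _ => (1 : ℝ)) x ≤ gap μ x := fun x => by
      rw [hgap]
      by_cases hx : μ x = 0
      · rw [Set.indicator_of_mem (by exact hx), hx]; simp
      · rw [Set.indicator_of_notMem (by exact hx)]; linarith [hμr x]
    have h0 : ∀ x, 0 ≤ gap μ x := fun x => by rw [hgap]; linarith [hμr x]
    calc r * π.missCount μ j n τ (p.1, π.rewards μ p.1 p.2)
        ≤ r * ∑ t ∈ before T τ, {x | μ x = 0}.indicator (fun _ => (1 : ℝ))
            (π.arm t p.1 (π.rewards μ p.1 p.2)) := by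
          refine mul_le_mul_of_nonneg_left (Set.indicator_le_self' (fun _ _ => ?_) _) hr
          exact Finset.sum_nonneg fun _ _ => Set.indicator_nonneg (fun _ _ => zero_le_one) _
      _ ≤ ∑ t ∈ before T τ, gap μ (π.arm t p.1 (π.rewards μ p.1 p.2)) := by
          rw [Finset.mul_sum]
          exact Finset.sum_le_sum fun t _ => h1 _
      _ ≤ π.regret μ p.1 p.2 :=
          Finset.sum_le_sum_of_subset_of_nonneg (Finset.subset_univ _) fun _ _ _ => h0 _

/-- If a batch is likely to be long under the zero instance, then the policy has a large regret
under one of many instances with disjoint supports. -/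
theorem exists_expectedRegret_ge (π : AdaptivePolicy d T B S) (P : Measure S)
    [IsProbabilityMeasure P] {ι : Type*} [Fintype ι] {μ : ι → Arm d → ℝ}
    (hμ : ∀ k, Measurable (μ k)) {r : ℝ} (hr : 0 ≤ r) (hμ0 : ∀ k x, 0 ≤ μ k x)
    (hμr : ∀ k x, μ k x ≤ r)
    (hz : ∀ k, ∃ z, μ k z = r) (hdisj : ∀ x k l, μ k x ≠ 0 → μ l x ≠ 0 → k = l)
    (hB : 1 ≤ B) (j : Fin B) {n τ : ℕ} (hn : n ≤ T) (hτ : τ ≤ T)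
    (hcard : 2 ≤ Fintype.card ι) (hM : 20 * (B : ℝ) ^ 2 * n * r ^ 2 ≤ Fintype.card ι)
    (hP : 1 / (B : ℝ) ≤ (P.prod (stdNoise T)).real (π.longBatch j n τ)) :
    ∃ k, r * τ / (4 * B) ≤ π.expectedRegret P (μ k) := by
  classical
  set Q := P.prod (stdNoise T) with hQ
  set M := ((Fintype.card ι : ℕ) : ℝ) with hMdef
  have hM2 : (2 : ℝ) ≤ M := by rw [hMdef]; exact_mod_cast hcard
  have hBr : (1 : ℝ) ≤ B := by exact_mod_cast hB
  -- With `c = 4 * B` the term `1 / (2 * c)` is `1 / (8 * B)`, a quarter of the main term `1 / (2 *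
  -- B)` from the misses.
  have hc : (0 : ℝ) < 4 * B := by positivity
  have h1 : ∀ k, _ := fun k => π.integral_le_integral_rewards P (hμ k) (hμ0 k) (hμr k) hn
    (π.measurable_missCount (hμ k) j n τ) (π.missCount_nonneg (μ k) j n τ)
    (π.missCount_le (μ k) j n hτ) (π.missCount_congr (μ k) j n τ) hc
  have h2 : ∀ k, r * (∫ p, π.missCount (μ k) j n τ p ∂Q -
      τ * (1 / (2 * (4 * B)) + (4 * B + 1) / 2 * ∫ p, π.energy (μ k) n p ∂Q)) ≤
      π.expectedRegret P (μ k) := fun k =>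
    (mul_le_mul_of_nonneg_left (by linarith [(h1 k).2]) hr).trans
      (π.integral_missCount_le_expectedRegret P (hμ k) (hμ0 k) (hμr k) (hz k) j n hτ)
  -- By disjointness of supports, an arm misses all instances but at most one; M - 1 ≥ M/2 is used
  -- below.
  have hcount : ∀ x, M - 1 ≤ ∑ k, {x | μ k x = 0}.indicator (fun _ => (1 : ℝ)) x := fun x => by
    have : ∑ k, (1 - {x | μ k x = 0}.indicator (fun _ => (1 : ℝ)) x) ≤ 1 := by
      by_cases h : ∃ k, μ k x ≠ 0
      · obtain ⟨k, hk⟩ := h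
        rw [Finset.sum_eq_single k]
        · rw [Set.indicator_of_notMem (by exact hk)]; simp
        · intro l _ hl
          rw [Set.indicator_of_mem (by exact not_not.mp fun hl' => hl (hdisj x l k hl' hk)),
            sub_self]
        · simp
      · push Not at h
        rw [Finset.sum_eq_zero]
        · exact zero_le_one
        · exact fun k _ => by rw [Set.indicator_of_mem (by exact h k), sub_self]
    rw [Finset.sum_sub_distrib] at this
    simp only [Finset.sum_const, Finset.card_univ, nsmul_eq_mul, mul_one] at this
    linarith
  have hsq : ∀ x, ∑ k, μ k x ^ 2 ≤ r ^ 2 := fun x => by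
    by_cases h : ∃ k, μ k x ≠ 0
    · obtain ⟨k, hk⟩ := h
      rw [Finset.sum_eq_single k]
      · exact pow_le_pow_left₀ (hμ0 k x) (hμr k x) 2
      · intro l _ hl
        rw [not_not.mp fun hl' => hl (hdisj x l k hl' hk)]; simp
      · simp
    · push Not at h
      rw [Finset.sum_eq_zero fun k _ => by rw [h k]; simp]
      positivity
  have hmiss : τ * (M / 2) * (1 / B) ≤ ∑ k, ∫ p, π.missCount (μ k) j n τ p ∂Q := by
    rw [← integral_finsetSum]
    · calc τ * (M / 2) * (1 / B) ≤ τ * (M / 2) * Q.real (π.longBatch j n τ) := by gcongr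
        _ = ∫ p, (π.longBatch j n τ).indicator (fun _ => τ * (M / 2)) p ∂Q := by
          rw [integral_indicator_const _ (π.measurableSet_longBatch j n τ), smul_eq_mul, mul_comm]
        _ ≤ _ := by
          refine integral_mono ((integrable_const _).indicator (π.measurableSet_longBatch j n τ))
            (integrable_finsetSum _ fun k _ => ?_) fun p => ?_
          · exact Integrable.of_bound (π.measurable_missCount (hμ k) j n τ).aestronglyMeasurable τ
              (ae_of_all _ fun p => by
                rw [Real.norm_of_nonneg (π.missCount_nonneg _ _ _ _ _)]
                exact π.missCount_le _ _ _ hτ _)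
          · by_cases hp : p ∈ π.longBatch j n τ
            · simp only [missCount, Set.indicator_of_mem hp]
              rw [Finset.sum_comm]
              have := Finset.card_nsmul_le_sum (before T τ) (fun t => ∑ k,
                {x | μ k x = 0}.indicator (fun _ => (1 : ℝ)) (π.arm t p.1 p.2)) (M - 1)
                fun t _ => hcount _
              rw [card_before hτ, nsmul_eq_mul] at this
              refine le_trans ?_ this
              gcongr
              linarith
            · simp only [missCount, Set.indicator_of_notMem hp]
              simp
    · exact fun k _ => Integrable.of_bound
        (π.measurable_missCount (hμ k) j n τ).aestronglyMeasurable τ (ae_of_all _ fun p => by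
          rw [Real.norm_of_nonneg (π.missCount_nonneg _ _ _ _ _)]
          exact π.missCount_le _ _ _ hτ _)
  have henergy : ∑ k, ∫ p, π.energy (μ k) n p ∂Q ≤ n * r ^ 2 := by
    rw [← integral_finsetSum _ fun k _ => (h1 k).1]
    calc _ ≤ ∫ _, (n * r ^ 2 : ℝ) ∂Q := by
          refine integral_mono (integrable_finsetSum _ fun k _ => (h1 k).1) (integrable_const _)
            fun p => ?_
          simp only [energy, variationPart, drift]
          rw [Finset.sum_comm]
          have := Finset.sum_le_card_nsmul (before T n) (fun t => ∑ k, μ k (π.arm t p.1 p.2) ^ 2)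
            (r ^ 2) fun t _ => hsq _
          rwa [card_before hn, nsmul_eq_mul] at this
      _ = _ := by simp
  have hsum : ∑ _k : ι, r * τ / (4 * B) ≤ ∑ k, π.expectedRegret P (μ k) := by
    refine le_trans ?_ (Finset.sum_le_sum fun k _ => h2 k)
    rw [← Finset.mul_sum, Finset.sum_sub_distrib, ← Finset.mul_sum, Finset.sum_add_distrib,
      ← Finset.mul_sum]
    simp only [Finset.sum_const, Finset.card_univ, nsmul_eq_mul, ← hMdef]
    have e : M * (r * τ / (4 * B)) = r * (τ * (M / (4 * B))) := by ring
    rw [e]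
    refine mul_le_mul_of_nonneg_left ?_ hr
    -- From 4B + 1 ≤ 5B and `hM`. The balance is then M/(2B) - M/(8B) - M/(8B) = M/(4B).
    have h3 : (4 * B + 1) / 2 * ∑ k, ∫ p, π.energy (μ k) n p ∂Q ≤ M / (8 * B) := by
      calc _ ≤ (5 * B) / 2 * (n * r ^ 2) := by
            gcongr
            · exact Finset.sum_nonneg fun k _ => integral_nonneg fun p => variationPart_nonneg _ _
            · linarith
        _ ≤ _ := by
            rw [le_div_iff₀ (by positivity)]
            linarith
    have h4 : (τ : ℝ) * (M * (1 / (2 * (4 * B))) +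
        (4 * B + 1) / 2 * ∑ k, ∫ p, π.energy (μ k) n p ∂Q) ≤
        τ * (M * (1 / (2 * (4 * B))) + M / (8 * B)) := by gcongr
    have e2 : τ * (M / 2) * (1 / B) - τ * (M * (1 / (2 * (4 * B))) + M / (8 * B)) =
        (τ : ℝ) * (M / (4 * B)) := by
      field_simp
      ring
    linarith
  have : Nonempty ι := Fintype.card_pos_iff.mp (by omega)
  obtain ⟨k, _, hk⟩ := Finset.exists_le_of_sum_le Finset.univ_nonempty hsum
  exact ⟨k, hk⟩

end AdaptivePolicy

end LipschitzBandit

/-! ### Peaked instances on a grid of cubes -/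

namespace LipschitzBandit

open MeasureTheory ProbabilityTheory

/-- The center of the cube with coordinates `k` of the grid with edge length `1 / m`. -/
noncomputable def cubeCenter {d m : ℕ} (k : Fin d → Fin m) : Arm d :=
  ⟨fun l => ((k l : ℕ) + 1 / 2 : ℝ) / m, by
    refine ⟨fun l => ?_, fun l => ?_⟩
    · simp only [Pi.zero_apply]; positivity
    · have hk : ((k l : ℕ) : ℝ) + 1 ≤ m := by exact_mod_cast (k l).2
      exact div_le_one_of_le₀ (by linarith) (Nat.cast_nonneg m)⟩

/-- The instance with a peak of height `1 / (2 m)` in one cube of edge length `1 / m`. -/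
noncomputable def bump {d m : ℕ} (k : Fin d → Fin m) (x : Arm d) : ℝ :=
  max 0 (1 / (2 * m) - dist x (cubeCenter k))

section bump

variable {d m : ℕ} (k : Fin d → Fin m)

theorem bump_nonneg (x : Arm d) : 0 ≤ bump k x := le_max_left _ _

theorem bump_le (x : Arm d) : bump k x ≤ 1 / (2 * m) :=
  max_le (by positivity) (sub_le_self _ dist_nonneg)

theorem bump_cubeCenter : bump k (cubeCenter k) = 1 / (2 * m) := by
  rw [bump, dist_self, sub_zero, max_eq_right (by positivity)]

theorem lipschitzWith_bump : LipschitzWith 1 (bump k) := by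
  refine LipschitzWith.of_le_add fun x y => max_le ?_ ?_
  · exact add_nonneg (bump_nonneg k y) dist_nonneg
  · have h1 : 1 / (2 * m) - dist y (cubeCenter k) ≤ bump k y := le_max_right _ _
    have h2 := dist_triangle_left y (cubeCenter k) x
    linarith [dist_comm x y]

variable {k}

/-- In the sup norm the support is controlled by an open ball that is an open cube; the strict
inequalities make distinct cubes disjoint. -/
theorem mem_cube_of_bump_ne_zero {x : Arm d} (hx : bump k x ≠ 0) (l : Fin d) :
    ((k l : ℕ) : ℝ) < m * x.1 l ∧ m * x.1 l < (k l : ℕ) + 1 := by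
  have hm : (0 : ℝ) < m := by exact_mod_cast (k l).pos
  have h1 : dist x (cubeCenter k) < 1 / (2 * m) := by
    by_contra! h
    exact hx (max_eq_left (by linarith))
  have h2 : |x.1 l - ((k l : ℕ) + 1 / 2) / m| < 1 / (2 * m) :=
    (dist_le_pi_dist x.1 (cubeCenter k).1 l).trans_lt h1
  have h3 : |m * x.1 l - ((k l : ℕ) + 1 / 2)| < 1 / 2 := by
    have e : m * x.1 l - ((k l : ℕ) + 1 / 2) = m * (x.1 l - ((k l : ℕ) + 1 / 2) / m) := by
      field_simp
    rw [e, abs_mul, abs_of_pos hm]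
    calc _ < (m : ℝ) * (1 / (2 * m)) := by gcongr
      _ = 1 / 2 := by field_simp
  rw [abs_lt] at h3
  constructor <;> linarith [h3.1, h3.2]

theorem eq_of_bump_ne_zero {k' : Fin d → Fin m} {x : Arm d} (h : bump k x ≠ 0)
    (h' : bump k' x ≠ 0) : k = k' := by
  funext l
  have h1 := mem_cube_of_bump_ne_zero h l
  have h2 := mem_cube_of_bump_ne_zero h' l
  have a : (k l : ℕ) < k' l + 1 := by exact_mod_cast h1.1.trans h2.2
  have b : (k' l : ℕ) < k l + 1 := by exact_mod_cast h2.1.trans h1.2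
  exact Fin.ext (by omega)

end bump

/-! ### The minimax lower bound -/

namespace AdaptivePolicy

variable {d T B : ℕ} {S : Type*} [MeasurableSpace S]

/-- If no batch were long, induction from `0 < τ 0` would keep each grid point `l` below `τ l`,
contradicting `τ B ≤ T` at the last one. -/
theorem exists_mem_longBatch (π : AdaptivePolicy d T B S) {τ : ℕ → ℕ} (h0 : 0 < τ 0)
    (hB : τ B ≤ T) (p : S × (Fin T → ℝ)) :
    ∃ j : Fin B, p ∈ π.longBatch j (τ j) (τ (j + 1)) := by
  by_contra! h
  have key : ∀ l : Fin (B + 1), π.grid l p.1 p.2 < τ l := by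
    intro l
    induction l using Fin.induction with
    | zero => rw [π.grid_zero]; exact h0
    | succ l ih =>
      by_contra! hl
      exact h l ⟨ih, hl⟩
  have h1 := key (Fin.last B)
  rw [π.grid_last, Fin.val_last] at h1
  omega

theorem exists_longBatch_prob_ge (π : AdaptivePolicy d T B S) (P : Measure S)
    [IsProbabilityMeasure P] (hB : 1 ≤ B) {τ : ℕ → ℕ} (h0 : 0 < τ 0) (hτB : τ B ≤ T) :
    ∃ j : Fin B, 1 / (B : ℝ) ≤ (P.prod (stdNoise T)).real (π.longBatch j (τ j) (τ (j + 1))) := by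
  have h : (Set.univ : Set (S × (Fin T → ℝ))) = ⋃ j : Fin B, π.longBatch j (τ j) (τ (j + 1)) :=
    (Set.eq_univ_of_forall fun p => Set.mem_iUnion.mpr (π.exists_mem_longBatch h0 hτB p)).symm
  have h1 : ∑ _j : Fin B, 1 / (B : ℝ) ≤
      ∑ j : Fin B, (P.prod (stdNoise T)).real (π.longBatch j (τ j) (τ (j + 1))) := by
    refine le_trans ?_ (measureReal_iUnion_fintype_le _)
    rw [← h, probReal_univ]
    have : (B : ℝ) ≠ 0 := by positivity
    simp [this]
  have : NeZero B := ⟨by omega⟩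
  obtain ⟨j, _, hj⟩ := Finset.exists_le_of_sum_le Finset.univ_nonempty h1
  exact ⟨j, hj⟩

/-- The minimax lower bound for policies with an adaptive grid. -/
theorem exists_lipschitz_expectedRegret_ge (π : AdaptivePolicy d T B S) (P : Measure S)
    [IsProbabilityMeasure P] (hd : 1 ≤ d) (hT : 1 ≤ T) (hB : 1 ≤ B) {ρ : ℝ}
    (hρ : ρ = 1 / ((d : ℝ) + 2)) :
    ∃ μ : Arm d → ℝ, LipschitzWith 1 μ ∧
      (T : ℝ) ^ ((1 - ρ) / (1 - ρ ^ B)) / (160 * (B : ℝ) ^ 2) ≤ π.expectedRegret P μ := by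
  have hd0 : (0 : ℝ) < (d : ℝ) + 2 := by positivity
  have hT1 : (1 : ℝ) ≤ T := by exact_mod_cast hT
  have hT0 : (0 : ℝ) < T := by linarith
  have hB1 : (1 : ℝ) ≤ B := by exact_mod_cast hB
  have hρ0 : 0 < ρ := by rw [hρ]; positivity
  have hρ1 : ρ < 1 := by
    rw [hρ, div_lt_one hd0]
    have : (0 : ℝ) ≤ d := Nat.cast_nonneg d
    linarith
  have hD : 0 < 1 - ρ ^ B := sub_pos.mpr (pow_lt_one₀ hρ0.le hρ1 (by omega))
  -- The solution of u_{j+1} = A u_j^ρ, u_0 = 1, u_B = T, with A = T^((1-ρ)/(1-ρ^B)). With m of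
  -- order u_j^ρ up to powers of B, the ratio u_{j+1}/m is then of order A for every j.
  set u : ℕ → ℝ := fun j => (T : ℝ) ^ ((1 - ρ ^ j) / (1 - ρ ^ B)) with hu
  have hu1 : ∀ j, 1 ≤ u j := fun j => Real.one_le_rpow hT1
    (div_nonneg (sub_nonneg.mpr (pow_le_one₀ hρ0.le hρ1.le)) hD.le)
  have huT : ∀ j ≤ B, u j ≤ T := fun j hj => by
    refine (Real.rpow_le_rpow_of_exponent_le hT1 (z := 1) ?_).trans
      (Real.rpow_one _).le
    rw [div_le_one hD]
    linarith [pow_le_pow_of_le_one hρ0.le hρ1.le hj]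
  have hτT : ∀ j ≤ B, ⌈u j⌉₊ ≤ T := fun j hj => Nat.ceil_le.mpr (huT j hj)
  obtain ⟨j, hj⟩ := π.exists_longBatch_prob_ge P hB (τ := fun j => ⌈u j⌉₊)
    (Nat.ceil_pos.mpr (by linarith [hu1 0])) (hτT B le_rfl)
  -- With ⌈u_j⌉ ≤ 2 u_j and r = 1/(2m), the energy condition 20 B² ⌈u_j⌉ r² ≤ m^d follows from a ≤
  -- m^(d+2). Also a > 1 forces m ≥ 2.
  set a : ℝ := 10 * (B : ℝ) ^ 2 * u j with ha
  have ha10 : 10 ≤ a := by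
    have : 1 ≤ (B : ℝ) ^ 2 := one_le_pow₀ hB1
    have := mul_le_mul this (hu1 j) zero_le_one (by positivity)
    rw [ha]; linarith
  have ha1 : 1 < a ^ ρ := Real.one_lt_rpow (by linarith) hρ0
  set m : ℕ := ⌈a ^ ρ⌉₊ with hm
  have hm1 : a ^ ρ ≤ m := Nat.le_ceil _
  have hm2 : 2 ≤ m := by
    have : (1 : ℝ) < m := ha1.trans_le hm1
    exact_mod_cast this
  have hm3 : (m : ℝ) ≤ 2 * a ^ ρ := by
    have := (Nat.ceil_lt_add_one (by positivity : 0 ≤ a ^ ρ)).le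
    linarith
  have hm0 : (0 : ℝ) < m := by positivity
  have ham : a ≤ (m : ℝ) ^ (d + 2) := by
    have h1 := pow_le_pow_left₀ (by positivity) hm1 (d + 2)
    rwa [← Real.rpow_natCast (a ^ ρ), ← Real.rpow_mul (by linarith), hρ, Nat.cast_add,
      Nat.cast_ofNat, one_div_mul_cancel hd0.ne', Real.rpow_one] at h1
  have hn : (⌈u j⌉₊ : ℝ) ≤ 2 * u j := by
    have := (Nat.ceil_lt_add_one (by linarith [hu1 j] : 0 ≤ u j)).le
    linarith [hu1 j]
  have hcard : Fintype.card (Fin d → Fin m) = m ^ d := by simp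
  obtain ⟨k, hk⟩ := π.exists_expectedRegret_ge P (μ := fun k : Fin d → Fin m => bump k)
    (fun k => (lipschitzWith_bump k).continuous.measurable) (r := 1 / (2 * m)) (by positivity)
    bump_nonneg bump_le (fun k => ⟨_, bump_cubeCenter k⟩) (fun x k l => eq_of_bump_ne_zero) hB j
    (hτT j j.2.le) (hτT (j + 1) j.2)
    (by rw [hcard]; exact hm2.trans (Nat.le_self_pow (by omega) m))
    (by
      rw [hcard, Nat.cast_pow]
      have h1 : 20 * (B : ℝ) ^ 2 * ⌈u j⌉₊ ≤ 4 * (m : ℝ) ^ (d + 2) := by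
        have : 20 * (B : ℝ) ^ 2 * ⌈u j⌉₊ ≤ 20 * (B : ℝ) ^ 2 * (2 * u j) := by gcongr
        linarith
      calc 20 * (B : ℝ) ^ 2 * ⌈u j⌉₊ * (1 / (2 * m)) ^ 2
          ≤ 4 * (m : ℝ) ^ (d + 2) * (1 / (2 * m)) ^ 2 := by gcongr
        _ = (m : ℝ) ^ d := by rw [pow_add]; field_simp; norm_num)
    hj
  refine ⟨bump k, lipschitzWith_bump k, le_trans ?_ hk⟩
  have hexp : (T : ℝ) ^ ((1 - ρ) / (1 - ρ ^ B)) * u j ^ ρ = u (j + 1) := by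
    simp only [hu]
    rw [← Real.rpow_mul hT0.le, ← Real.rpow_add hT0]
    congr 1
    field_simp
    ring
  -- Since ρ (d+2) = 1, bounding 10 B² by (10 B)^(d+2) gives a constant independent of d. This costs
  -- one factor B; the other comes from the pigeonhole.
  have haρ : a ^ ρ ≤ 10 * B * u j ^ ρ := by
    rw [ha, Real.mul_rpow (by positivity) (by linarith [hu1 j])]
    gcongr
    calc (10 * (B : ℝ) ^ 2) ^ ρ ≤ ((10 * (B : ℝ)) ^ (d + 2)) ^ ρ := by
          refine Real.rpow_le_rpow (by positivity) ?_ hρ0.le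
          calc 10 * (B : ℝ) ^ 2 ≤ (10 * (B : ℝ)) ^ 2 := by nlinarith
            _ ≤ _ := pow_le_pow_right₀ (by linarith) (by omega)
      _ = 10 * B := by
          rw [← Real.rpow_natCast, ← Real.rpow_mul (by positivity), hρ, Nat.cast_add,
            Nat.cast_ofNat, mul_one_div_cancel hd0.ne', Real.rpow_one]
  have hup : 0 < u j ^ ρ := Real.rpow_pos_of_pos (by linarith [hu1 j]) _
  rw [div_le_div_iff₀ (by positivity) (by positivity)]
  have hceil : u (j + 1) ≤ ⌈u (j + 1)⌉₊ := Nat.le_ceil _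
  have hmB : (m : ℝ) ≤ 20 * B * u j ^ ρ := by linarith
  have hA : 0 ≤ (T : ℝ) ^ ((1 - ρ) / (1 - ρ ^ B)) := by positivity
  calc (T : ℝ) ^ ((1 - ρ) / (1 - ρ ^ B)) * (4 * B)
      = 1 / (2 * m) * ((T : ℝ) ^ ((1 - ρ) / (1 - ρ ^ B)) * m * (8 * B)) := by field_simp; norm_num
    _ ≤ 1 / (2 * m) * ((T : ℝ) ^ ((1 - ρ) / (1 - ρ ^ B)) * (20 * B * u j ^ ρ) * (8 * B)) := by
        gcongr
    _ = 1 / (2 * m) * u (j + 1) * (160 * (B : ℝ) ^ 2) := by rw [← hexp]; ring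
    _ ≤ 1 / (2 * m) * ⌈u (j + 1)⌉₊ * (160 * (B : ℝ) ^ 2) := by gcongr

end AdaptivePolicy

/-! ### Upper bound for the zooming rate -/

theorem zoomingNumber_le {d : ℕ} (μ : Arm d → ℝ) (i : ℕ) : zoomingNumber μ i ≤ (2 ^ i) ^ d := by
  refine (Set.ncard_le_card _).trans ?_
  simp

theorem zoomingRate_nonneg {d : ℕ} (μ : Arm d → ℝ) (T : ℕ) : 0 ≤ zoomingRate μ T :=
  Real.iInf_nonneg fun r₀ => add_nonneg (mul_nonneg (le_of_lt r₀.2) (Nat.cast_nonneg T))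
    (finsum_nonneg fun i => finsum_nonneg fun _ =>
      mul_nonneg (by positivity) (Real.log_natCast_nonneg T))

/-- Take r₀ = 2^(-k), bound each zooming number by the total number of cubes, and sum a geometric
series. -/
theorem zoomingRate_le_of_scale {d : ℕ} (μ : Arm d → ℝ) (T k : ℕ) :
    zoomingRate μ T ≤ (1 / 2) ^ k * T + 2 * (2 ^ k) ^ (d + 1) * Real.log T := by
  have hlog : 0 ≤ Real.log T := Real.log_natCast_nonneg T
  have hbdd : BddBelow (Set.range fun r₀ : Set.Ioi (0 : ℝ) => ((r₀ : ℝ) * T +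
      ∑ᶠ (i : ℕ) (_ : (r₀ : ℝ) ≤ (1 / 2) ^ i),
        (zoomingNumber μ i : ℝ) / (1 / 2) ^ i * Real.log T)) := by
    refine ⟨0, ?_⟩
    rintro _ ⟨r₀, rfl⟩
    exact add_nonneg (mul_nonneg (le_of_lt r₀.2) (Nat.cast_nonneg T))
      (finsum_nonneg fun i => finsum_nonneg fun _ => mul_nonneg (by positivity) hlog)
  refine (ciInf_le hbdd ⟨(1 / 2) ^ k, by simp⟩).trans ?_
  simp only []
  gcongr
  have hiff : ∀ i : ℕ, (1 / 2 : ℝ) ^ k ≤ (1 / 2) ^ i ↔ i ∈ Finset.range (k + 1) := fun i => by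
    rw [pow_le_pow_iff_right_of_lt_one₀ (by norm_num) (by norm_num), Finset.mem_range]
    omega
  simp only [hiff]
  rw [finsum_mem_finset_eq_sum, ← Finset.sum_mul]
  gcongr
  have hterm : ∀ i ∈ Finset.range (k + 1), (zoomingNumber μ i : ℝ) / (1 / 2) ^ i ≤
      (2 ^ k) ^ d * 2 ^ i := fun i hi => by
    have h1 : (zoomingNumber μ i : ℝ) ≤ (2 ^ i) ^ d := by exact_mod_cast zoomingNumber_le μ i
    have h2 : ((2 : ℝ) ^ i) ^ d ≤ (2 ^ k) ^ d := by
      gcongr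
      · norm_num
      · exact Finset.mem_range_succ_iff.mp hi
    rw [one_div, inv_pow, div_inv_eq_mul]
    gcongr
    exact h1.trans h2
  refine (Finset.sum_le_sum hterm).trans ?_
  rw [← Finset.mul_sum, geom_sum_eq (by norm_num), pow_succ (2 ^ k : ℝ) d,
    mul_comm 2, mul_assoc]
  gcongr
  rw [pow_succ]
  norm_num

theorem zoomingRate_le {d : ℕ} (μ : Arm d → ℝ) {T : ℕ} (hT : 2 ≤ T) {ρ : ℝ}
    (hρ : ρ = 1 / ((d : ℝ) + 2)) :
    zoomingRate μ T ≤ 4 * ((T : ℝ) ^ (1 - ρ) * Real.log T ^ ρ) := by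
  have hd0 : (0 : ℝ) < (d : ℝ) + 2 := by positivity
  have hρ0 : 0 < ρ := by rw [hρ]; positivity
  have hT0 : (0 : ℝ) < T := by positivity
  have hL : 0 < Real.log T := Real.log_pos (by exact_mod_cast hT)
  set q : ℝ := T / Real.log T with hq
  have hq1 : 1 ≤ q := by
    rw [hq, one_le_div hL]
    linarith [Real.log_le_sub_one_of_pos hT0]
  have hq0 : 0 < q := by linarith
  -- The scale 2^k ≈ (T / log T)^ρ balances the two terms; rounding to a power of two costs a factor
  -- 2 in the first.
  obtain ⟨k, hk1, hk2⟩ := exists_nat_pow_near (Real.one_le_rpow hq1 hρ0.le) one_lt_two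
  have hqρ : 0 < q ^ ρ := by positivity
  have e1 : (T : ℝ) / q ^ ρ = (T : ℝ) ^ (1 - ρ) * Real.log T ^ ρ := by
    rw [hq, Real.div_rpow hT0.le hL.le, Real.rpow_sub hT0, Real.rpow_one]
    field_simp
  have e2 : (q ^ ρ) ^ (d + 1) * Real.log T = (T : ℝ) / q ^ ρ := by
    have : (q ^ ρ) ^ (d + 1) * q ^ ρ = q := by
      rw [← pow_succ, ← Real.rpow_natCast, ← Real.rpow_mul hq0.le, hρ]
      push_cast
      rw [show (1 / ((d : ℝ) + 2)) * (d + 1 + 1) = 1 by field_simp; ring, Real.rpow_one]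
    rw [eq_div_iff hqρ.ne']
    calc _ = (q ^ ρ) ^ (d + 1) * q ^ ρ * Real.log T := by ring
      _ = T := by rw [this, hq]; field_simp
  have h1 : (1 / 2 : ℝ) ^ k * T ≤ 2 * (T / q ^ ρ) := by
    rw [one_div, inv_pow, ← mul_div_assoc, le_div_iff₀ hqρ]
    calc ((2 : ℝ) ^ k)⁻¹ * T * q ^ ρ ≤ ((2 : ℝ) ^ k)⁻¹ * T * 2 ^ (k + 1) := by gcongr
      _ = 2 * T := by rw [pow_succ]; field_simp
  have h2 : ((2 : ℝ) ^ k) ^ (d + 1) * Real.log T ≤ T / q ^ ρ := by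
    rw [← e2]
    gcongr
  have := zoomingRate_le_of_scale μ T k
  rw [← e1]
  linarith

end LipschitzBandit

/-! ### Conclusion -/

theorem mainTheorem2 :
    ∃ c : ℝ, 0 < c ∧
      ∀ (d T B : ℕ), 1 ≤ d → 2 ≤ T → 1 ≤ B →
      ∀ (S : Type*) [MeasurableSpace S] (P : MeasureTheory.Measure S)
        [MeasureTheory.IsProbabilityMeasure P]
        (π : LipschitzBandit.AdaptivePolicy d T B S),
      ∃ μ : LipschitzBandit.Arm d → ℝ, LipschitzWith 1 μ ∧
        π.expectedRegret P μ ≥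
          c * (1 / (B : ℝ) ^ 2) *
            Real.log T ^ (-((1 / ((d : ℝ) + 2)) / (1 - (1 / ((d : ℝ) + 2)) ^ B))) *
            LipschitzBandit.zoomingRate μ T ^ (1 / (1 - (1 / ((d : ℝ) + 2)) ^ B)) := by
  -- 2560 = 160 · 16: the minimax constant times the bound 4² for 4^(1/(1-ρ^B)), whose exponent is
  -- at most 2 because ρ^B ≤ 1/2.
  refine ⟨1 / 2560, by norm_num, fun d T B hd hT hB S _ P _ π => ?_⟩
  obtain ⟨ρ, hρ⟩ : ∃ ρ : ℝ, ρ = 1 / ((d : ℝ) + 2) := ⟨_, rfl⟩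
  obtain ⟨μ, hμ, hreg⟩ := π.exists_lipschitz_expectedRegret_ge P hd (by omega) hB hρ
  refine ⟨μ, hμ, le_trans ?_ hreg⟩
  rw [← hρ]
  have hd0 : (0 : ℝ) < (d : ℝ) + 2 := by positivity
  have hρ0 : 0 < ρ := by rw [hρ]; positivity
  have hρ2 : ρ ≤ 1 / 2 := by
    rw [hρ]
    exact one_div_le_one_div_of_le two_pos (by linarith [Nat.cast_nonneg (α := ℝ) d])
  have hρB : ρ ^ B ≤ 1 / 2 := (pow_le_of_le_one hρ0.le (by linarith) (by omega)).trans hρ2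
  have hD : 0 < 1 - ρ ^ B := by linarith
  have hT0 : (0 : ℝ) < T := by positivity
  have hL : 0 < Real.log T := Real.log_pos (by exact_mod_cast hT)
  have hz : LipschitzBandit.zoomingRate μ T ^ (1 / (1 - ρ ^ B)) ≤
      16 * ((T : ℝ) ^ ((1 - ρ) / (1 - ρ ^ B)) * Real.log T ^ (ρ / (1 - ρ ^ B))) := by
    refine (Real.rpow_le_rpow (LipschitzBandit.zoomingRate_nonneg μ T)
      (LipschitzBandit.zoomingRate_le μ hT hρ) (by positivity)).trans ?_
    rw [Real.mul_rpow (by norm_num) (by positivity), Real.mul_rpow (by positivity) (by positivity),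
      ← Real.rpow_mul hT0.le, ← Real.rpow_mul hL.le, mul_one_div, mul_one_div]
    gcongr
    calc (4 : ℝ) ^ (1 / (1 - ρ ^ B)) ≤ 4 ^ (2 : ℝ) := by
          refine Real.rpow_le_rpow_of_exponent_le (by norm_num) ?_
          rw [div_le_iff₀ hD]
          linarith
      _ = 16 := by norm_num
  calc 1 / 2560 * (1 / (B : ℝ) ^ 2) * Real.log T ^ (-(ρ / (1 - ρ ^ B))) *
        LipschitzBandit.zoomingRate μ T ^ (1 / (1 - ρ ^ B))
      ≤ 1 / 2560 * (1 / (B : ℝ) ^ 2) * Real.log T ^ (-(ρ / (1 - ρ ^ B))) *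
        (16 * ((T : ℝ) ^ ((1 - ρ) / (1 - ρ ^ B)) * Real.log T ^ (ρ / (1 - ρ ^ B)))) := by gcongr
    _ = (T : ℝ) ^ ((1 - ρ) / (1 - ρ ^ B)) / (160 * (B : ℝ) ^ 2) := by
        have : 0 < Real.log T ^ (ρ / (1 - ρ ^ B)) := by positivity
        rw [Real.rpow_neg hL.le]
        field_simp
        norm_num
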